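/- Let $\sigma$ denote complex conjugation on $\mathbb{C}$, let $\mathbb{C}[T,\sigma]$ be the skew polynomial ring with $Ta=\sigma(a)T$ for $a\in\mathbb{C}$, and let $\mathbb{C}(T,\sigma)$ be its division ring of fractions. Let $\mathbb{H}=\mathbb{R}\oplus\mathbb{R}i\oplus\mathbb{R}j\oplus\mathbb{R}k$ be Hamilton's quaternions, with $\mathbb{C}=\mathbb{R}\oplus\mathbb{R}i\subseteq\mathbb{H}$, let $\mathbb{H}[X]$ be the polynomial ring over $\mathbb{H}$ in a central variable $X$, and let $\mathbb{H}(X)$ be its division ring of fractions. Let $\phi:\mathbb{C}(T,\sigma)\to\mathbb{H}(X)$ be the embedding that extends the injective ring homomorphism $\mathbb{C}[T,\sigma]\to\mathbb{H}[X]$, $\sum_n a_nT^n\mapsto\sum_n a_nj^nX^n$ (so $\phi$ is the identity on $\mathbb{C}$ and $\phi(T)=jX$). Extend $\sigma$ to $\mathbb{H}$ by $\sigma(a+bi+cj+dk)=a-bi+cj-dk$ for $a,b,c,d\in\mathbb{R}$, then to $\mathbb{H}[X]$ by acting on coefficients, and then to $\mathbb{H}(X)$ by $\sigma(PQ^{-1})=\sigma(P)\sigma(Q)^{-1}$.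 **Theorem.** Let $L$ be a division ring with $\mathbb{C}\subseteq L\subseteq\mathbb{C}(T,\sigma)$ such that $\sigma(\phi(L))=\phi(L)$. Then there is $v\in\mathbb{C}(T,\sigma)$ such that $L=\mathbb{C}(v)$, where $\mathbb{C}(v)$ denotes the intersection of all division rings contained in $\mathbb{C}(T,\sigma)$ that contain both $\mathbb{C}$ and $v$. -/

import Mathlib

open scoped nonZeroDivisors Quaternion Polynomial

noncomputable section

namespace ConjSkew

/-! ### Generalities: Ore domains and their division rings of fractions -/

section Ore

variable {R : Type*} [Ring R] [NoZeroDivisors R] [Nontrivial R]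

/-- A domain in which leading terms can be cancelled on the left satisfies the left Ore
condition. -/
theorem left_ore_of_step (d : R → ℕ)
    (step : ∀ a b : R, a ≠ 0 → b ≠ 0 → d b ≤ d a → ∃ q, a = q * b ∨ d (a - q * b) < d a) :
    ∀ a b : R, a ≠ 0 → b ≠ 0 → ∃ s r : R, s ≠ 0 ∧ r ≠ 0 ∧ s * a = r * b := by
  suffices H : ∀ n : ℕ, ∀ a b : R, a ≠ 0 → b ≠ 0 → d a + d b ≤ n →
      ∃ s r : R, s ≠ 0 ∧ r ≠ 0 ∧ s * a = r * b from
    fun a b ha hb => H _ a b ha hb le_rfl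
  intro n
  induction n using Nat.strong_induction_on with
  | _ n ih =>
    suffices H' : ∀ a b : R, a ≠ 0 → b ≠ 0 → d b ≤ d a → d a + d b ≤ n →
        ∃ s r : R, s ≠ 0 ∧ r ≠ 0 ∧ s * a = r * b by
      intro a b ha hb hn
      rcases le_total (d b) (d a) with h | h
      · exact H' a b ha hb h hn
      · obtain ⟨s, r, hs, hr, e⟩ := H' b a hb ha h (by omega)
        exact ⟨r, s, hr, hs, e.symm⟩
    intro a b ha hb hab hn
    obtain ⟨q, hq⟩ := step a b ha hb hab
    by_cases hz : a = q * b
    · refine ⟨1, q, one_ne_zero, ?_, by rw [one_mul, hz]⟩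
      rintro rfl
      exact ha (by rw [hz, zero_mul])
    · have hlt : d (a - q * b) < d a := hq.resolve_left hz
      obtain ⟨s, r, hs, -, e⟩ := ih (d (a - q * b) + d b) (by omega) (a - q * b) b
        (sub_ne_zero.mpr hz) hb le_rfl
      have e' : s * a = (r + s * q) * b := by
        rw [mul_sub] at e
        rw [add_mul, ← e, mul_assoc]
        abel
      refine ⟨s, r + s * q, hs, ?_, e'⟩
      intro h0
      rw [h0, zero_mul] at e'
      exact (mul_ne_zero hs ha) e'

/-- A domain in which leading terms can be cancelled on the right satisfies the right Ore
condition. -/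
theorem right_ore_of_step (d : R → ℕ)
    (step : ∀ a b : R, a ≠ 0 → b ≠ 0 → d b ≤ d a → ∃ q, a = b * q ∨ d (a - b * q) < d a)
    (a b : R) (ha : a ≠ 0) (hb : b ≠ 0) : ∃ s r : R, s ≠ 0 ∧ r ≠ 0 ∧ a * s = b * r := by
  obtain ⟨s, r, hs, hr, e⟩ := left_ore_of_step (R := Rᵐᵒᵖ) (fun x => d x.unop)
    (fun x y hx hy hxy => by
      obtain ⟨q, hq⟩ := step x.unop y.unop (by simpa using hx) (by simpa using hy) hxy
      refine ⟨MulOpposite.op q, hq.imp (fun h => ?_) (fun h => ?_)⟩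
      · apply MulOpposite.unop_injective
        simpa using h
      · simpa using h)
    (MulOpposite.op a) (MulOpposite.op b) (by simpa using ha) (by simpa using hb)
  refine ⟨s.unop, r.unop, by simpa using hs, by simpa using hr, ?_⟩
  simpa using congrArg MulOpposite.unop e

/-- The left Ore condition makes the set of non-zero elements an Ore set. -/
@[reducible]
def oreSet (h : ∀ a b : R, a ≠ 0 → b ≠ 0 → ∃ s r : R, s ≠ 0 ∧ r ≠ 0 ∧ s * a = r * b) :
    OreLocalization.OreSet R⁰ :=
  Classical.choice <| OreLocalization.nonempty_oreSet_iff_of_noZeroDivisors.mpr fun a b => by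
    by_cases ha : a = 0
    · exact ⟨0, 1, by simp [ha]⟩
    · obtain ⟨s, r, hs, -, e⟩ := h a b ha (nonZeroDivisors.coe_ne_zero b)
      exact ⟨r, ⟨s, mem_nonZeroDivisors_of_ne_zero hs⟩, e⟩

variable [OreLocalization.OreSet R⁰]

/-- The division ring of fractions of an Ore domain `R`. -/
abbrev Frac (R : Type*) [Ring R] [NoZeroDivisors R] [Nontrivial R] [OreLocalization.OreSet R⁰] :
    Type _ :=
  OreLocalization R⁰ R

/-- The inclusion of an Ore domain in its division ring of fractions. -/
abbrev toFrac (R : Type*) [Ring R] [NoZeroDivisors R] [Nontrivial R]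
    [OreLocalization.OreSet R⁰] : R →+* Frac R :=
  OreLocalization.numeratorRingHom

theorem toFrac_injective : Function.Injective (toFrac R) :=
  OreLocalization.numeratorHom_inj inf_le_left

theorem toFrac_ne_zero {b : R} (hb : b ≠ 0) : toFrac R b ≠ 0 :=
  (map_ne_zero_iff _ toFrac_injective).mpr hb

theorem exists_eq_inv_mul (x : Frac R) :
    ∃ s r : R, s ≠ 0 ∧ x = (toFrac R s)⁻¹ * toFrac R r := by
  induction x using OreLocalization.ind with
  | _ r s =>
    refine ⟨s, r, nonZeroDivisors.coe_ne_zero s, ?_⟩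
    rw [eq_inv_mul_iff_mul_eq₀ (toFrac_ne_zero (nonZeroDivisors.coe_ne_zero s))]
    exact OreLocalization.mul_cancel

/-- If `R` is also a right Ore domain, then every element of its division ring of fractions is of
the form `a * b⁻¹` with `a b : R`, `b ≠ 0`. -/
theorem exists_eq_mul_inv
    (h : ∀ a b : R, a ≠ 0 → b ≠ 0 → ∃ s r : R, s ≠ 0 ∧ r ≠ 0 ∧ a * s = b * r) (x : Frac R) :
    ∃ a b : R, b ≠ 0 ∧ x = toFrac R a * (toFrac R b)⁻¹ := by
  obtain ⟨s, r, hs, rfl⟩ := exists_eq_inv_mul x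
  by_cases hr : r = 0
  · exact ⟨0, 1, one_ne_zero, by simp [hr]⟩
  · obtain ⟨b, a, hb, -, e⟩ := h r s hr hs
    refine ⟨a, b, hb, ?_⟩
    rw [eq_mul_inv_iff_mul_eq₀ (toFrac_ne_zero hb), mul_assoc,
      inv_mul_eq_iff_eq_mul₀ (toFrac_ne_zero hs), ← map_mul, ← map_mul, e]

variable {D : Type*} [DivisionRing D]

/-- The unique extension to the division ring of fractions of an injective ring homomorphism
from an Ore domain to a division ring. -/
def fracLift (f : R →+* D) (hf : Function.Injective f) : Frac R →+* D :=
  OreLocalization.universalHom f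
    { toFun := fun s => Units.mk0 (f s)
        ((map_ne_zero_iff f hf).mpr (nonZeroDivisors.coe_ne_zero s))
      map_one' := by ext; simp
      map_mul' := fun s t => by ext; simp }
    (fun _ => rfl)

theorem fracLift_toFrac (f : R →+* D) (hf : Function.Injective f) (a : R) :
    fracLift f hf (toFrac R a) = f a :=
  OreLocalization.universalHom_commutes _ _ _

theorem fracLift_mul_inv (f : R →+* D) (hf : Function.Injective f) (a b : R) :
    fracLift f hf (toFrac R a * (toFrac R b)⁻¹) = f a * (f b)⁻¹ := by
  rw [map_mul, map_inv₀, fracLift_toFrac, fracLift_toFrac]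

end Ore

/-! ### The quaternions, the ring `ℍ[X]` (central variable `X`) and its fractions `ℍ(X)` -/

/-- The quaternion `j`. -/
def j : ℍ[ℝ] := ⟨0, 0, 1, 0⟩

@[simp] theorem j_re : j.re = 0 := rfl

@[simp] theorem j_imI : j.imI = 0 := rfl

@[simp] theorem j_imJ : j.imJ = 1 := rfl

@[simp] theorem j_imK : j.imK = 0 := rfl

theorem j_ne_zero : j ≠ 0 := by
  intro h
  simpa using congrArg QuaternionAlgebra.imJ h

/-- The map `a + bi + cj + dk ↦ a - bi + cj - dk`. -/
def sigmaQuatFun (q : ℍ[ℝ]) : ℍ[ℝ] := ⟨q.re, -q.imI, q.imJ, -q.imK⟩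

@[simp] theorem sigmaQuatFun_re (q : ℍ[ℝ]) : (sigmaQuatFun q).re = q.re := rfl

@[simp] theorem sigmaQuatFun_imI (q : ℍ[ℝ]) : (sigmaQuatFun q).imI = -q.imI := rfl

@[simp] theorem sigmaQuatFun_imJ (q : ℍ[ℝ]) : (sigmaQuatFun q).imJ = q.imJ := rfl

@[simp] theorem sigmaQuatFun_imK (q : ℍ[ℝ]) : (sigmaQuatFun q).imK = -q.imK := rfl

/-- The automorphism `a + bi + cj + dk ↦ a - bi + cj - dk` of `ℍ`, which extends complex
conjugation. -/
def sigmaQuat : ℍ[ℝ] ≃+* ℍ[ℝ] where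
  toFun := sigmaQuatFun
  invFun := sigmaQuatFun
  left_inv q := by ext <;> simp
  right_inv q := by ext <;> simp
  map_mul' p q := by ext <;> simp <;> ring
  map_add' p q := by ext <;> simp <;> ring

theorem sigmaQuat_coe (z : ℂ) : sigmaQuat (z : ℍ[ℝ]) = ((starRingEnd ℂ z : ℂ) : ℍ[ℝ]) := by
  ext <;> simp [sigmaQuat]

theorem quatPoly_cancel {a t : ℍ[ℝ][X]} (ha : a ≠ 0) (ht : t.natDegree = a.natDegree)
    (hc : t.leadingCoeff = a.leadingCoeff) : a = t ∨ (a - t).natDegree < a.natDegree := by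
  by_cases h : a = t
  · exact Or.inl h
  · right
    have ht0 : t ≠ 0 := by
      rintro rfl
      simp only [Polynomial.leadingCoeff_zero] at hc
      exact ha (Polynomial.leadingCoeff_eq_zero.mp hc.symm)
    refine Polynomial.natDegree_lt_natDegree (sub_ne_zero.mpr h)
      (Polynomial.degree_sub_lt_left ?_ ha hc.symm)
    rw [Polynomial.degree_eq_natDegree ha, Polynomial.degree_eq_natDegree ht0, ht]

theorem quatPoly_step_left (a b : ℍ[ℝ][X]) (ha : a ≠ 0) (hb : b ≠ 0)
    (h : b.natDegree ≤ a.natDegree) :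
    ∃ q, a = q * b ∨ (a - q * b).natDegree < a.natDegree := by
  have hb' : b.leadingCoeff ≠ 0 := Polynomial.leadingCoeff_ne_zero.mpr hb
  have ha' : a.leadingCoeff ≠ 0 := Polynomial.leadingCoeff_ne_zero.mpr ha
  have hc : a.leadingCoeff * b.leadingCoeff⁻¹ ≠ 0 := mul_ne_zero ha' (inv_ne_zero hb')
  have hq : Polynomial.monomial (a.natDegree - b.natDegree)
      (a.leadingCoeff * b.leadingCoeff⁻¹) ≠ 0 := by
    simpa only [ne_eq, Polynomial.monomial_eq_zero_iff] using hc
  refine ⟨Polynomial.monomial (a.natDegree - b.natDegree) (a.leadingCoeff * b.leadingCoeff⁻¹),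
    quatPoly_cancel ha ?_ ?_⟩
  · rw [Polynomial.natDegree_mul hq hb, Polynomial.natDegree_monomial_eq _ hc]
    omega
  · rw [Polynomial.leadingCoeff_mul, Polynomial.leadingCoeff_monomial,
      inv_mul_cancel_right₀ hb']

theorem quatPoly_step_right (a b : ℍ[ℝ][X]) (ha : a ≠ 0) (hb : b ≠ 0)
    (h : b.natDegree ≤ a.natDegree) :
    ∃ q, a = b * q ∨ (a - b * q).natDegree < a.natDegree := by
  have hb' : b.leadingCoeff ≠ 0 := Polynomial.leadingCoeff_ne_zero.mpr hb
  have ha' : a.leadingCoeff ≠ 0 := Polynomial.leadingCoeff_ne_zero.mpr ha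
  have hc : b.leadingCoeff⁻¹ * a.leadingCoeff ≠ 0 := mul_ne_zero (inv_ne_zero hb') ha'
  have hq : Polynomial.monomial (a.natDegree - b.natDegree)
      (b.leadingCoeff⁻¹ * a.leadingCoeff) ≠ 0 := by
    simpa only [ne_eq, Polynomial.monomial_eq_zero_iff] using hc
  refine ⟨Polynomial.monomial (a.natDegree - b.natDegree) (b.leadingCoeff⁻¹ * a.leadingCoeff),
    quatPoly_cancel ha ?_ ?_⟩
  · rw [Polynomial.natDegree_mul hb hq, Polynomial.natDegree_monomial_eq _ hc]
    omega
  · rw [Polynomial.leadingCoeff_mul, Polynomial.leadingCoeff_monomial,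
      mul_inv_cancel_left₀ hb']

instance quatPolyOreSet : OreLocalization.OreSet (ℍ[ℝ][X])⁰ :=
  oreSet (left_ore_of_step Polynomial.natDegree quatPoly_step_left)

/-- The division ring `ℍ(X)`. -/
abbrev QuatFrac : Type := Frac ℍ[ℝ][X]

theorem QuatFrac.exists_eq_mul_inv (x : QuatFrac) :
    ∃ P Q : ℍ[ℝ][X], Q ≠ 0 ∧ x = toFrac _ P * (toFrac _ Q)⁻¹ :=
  ConjSkew.exists_eq_mul_inv (right_ore_of_step Polynomial.natDegree quatPoly_step_right) x

/-- The extension of `σ` to `ℍ(X)`: it acts on the coefficients of polynomials, and maps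
`P * Q⁻¹` to `σ P * (σ Q)⁻¹`. -/
def sigmaFrac : QuatFrac →+* QuatFrac :=
  fracLift ((toFrac ℍ[ℝ][X]).comp (Polynomial.mapRingHom (sigmaQuat : ℍ[ℝ] →+* ℍ[ℝ])))
    (toFrac_injective.comp (Polynomial.map_injective _ sigmaQuat.injective))

theorem sigmaFrac_mul_inv (P Q : ℍ[ℝ][X]) :
    sigmaFrac (toFrac _ P * (toFrac _ Q)⁻¹) =
      toFrac _ (P.map (sigmaQuat : ℍ[ℝ] →+* ℍ[ℝ])) *
        (toFrac _ (Q.map (sigmaQuat : ℍ[ℝ] →+* ℍ[ℝ])))⁻¹ :=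
  fracLift_mul_inv _ _ P Q

theorem sigmaFrac_sigmaFrac (x : QuatFrac) : sigmaFrac (sigmaFrac x) = x := by
  have h : ∀ P : ℍ[ℝ][X], (P.map (sigmaQuat : ℍ[ℝ] →+* ℍ[ℝ])).map
      (sigmaQuat : ℍ[ℝ] →+* ℍ[ℝ]) = P := by
    intro P
    ext n : 1
    rw [Polynomial.coeff_map, Polynomial.coeff_map]
    exact sigmaQuat.left_inv _
  obtain ⟨P, Q, -, rfl⟩ := QuatFrac.exists_eq_mul_inv x
  rw [sigmaFrac_mul_inv, sigmaFrac_mul_inv, h, h]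

/-- A subset of `ℍ(X)` is `σ`-invariant if `σ(S) = S`. -/
def IsSigmaInvariant (S : Set QuatFrac) : Prop := sigmaFrac '' S = S

/-! ### The skew polynomial ring `ℂ[T, σ]` and its fractions `ℂ(T, σ)` -/

/-- The twist `T * a = conj a * T` of the skew polynomial ring over `ℂ`: the `n`-th power of `T`
acts on the coefficients by the `n`-th iterate of complex conjugation. -/
instance conjAction : MulSemiringAction (Multiplicative ℕ) ℂ where
  smul n z := (starRingEnd ℂ)^[n.toAdd] z
  one_smul _ := rfl
  mul_smul m n z := Function.iterate_add_apply (starRingEnd ℂ) m.toAdd n.toAdd z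
  smul_zero n := iterate_map_zero (starRingEnd ℂ) n.toAdd
  smul_add n := iterate_map_add (starRingEnd ℂ) n.toAdd
  smul_one n := iterate_map_one (starRingEnd ℂ) n.toAdd
  smul_mul n := iterate_map_mul (starRingEnd ℂ) n.toAdd

theorem conjAction_smul (n : Multiplicative ℕ) (z : ℂ) :
    n • z = (starRingEnd ℂ)^[n.toAdd] z := rfl

/-- The skew polynomial ring `ℂ[T, σ]`, with `σ` the complex conjugation. -/
abbrev SkewPoly : Type := SkewPolynomial ℂ

theorem monomial_mul_monomial (m n : ℕ) (a b : ℂ) :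
    (SkewPolynomial.monomial m a : SkewPoly) * SkewPolynomial.monomial n b =
      SkewPolynomial.monomial (m + n) (a * (starRingEnd ℂ)^[m] b) :=
  SkewMonoidAlgebra.single_mul_single

theorem j_pow_mul_coe (n : ℕ) (a : ℂ) :
    j ^ n * (a : ℍ[ℝ]) = (((starRingEnd ℂ)^[n] a : ℂ) : ℍ[ℝ]) * j ^ n := by
  induction n generalizing a with
  | zero => simp
  | succ n ih =>
    have h : j * (a : ℍ[ℝ]) = ((starRingEnd ℂ a : ℂ) : ℍ[ℝ]) * j := by
      ext <;> simp
    rw [pow_succ, mul_assoc, h, ← mul_assoc, ih, Function.iterate_succ_apply, mul_assoc]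

/-- The ring homomorphism `ℂ[T, σ] → ℍ[X]` which maps `a₀ + a₁ T + ⋯ + aₙ Tⁿ` to
`a₀ + a₁ j X + ⋯ + aₙ jⁿ Xⁿ`. -/
def phiPoly : SkewPoly →+* ℍ[ℝ][X] :=
  SkewMonoidAlgebra.liftNCRingHom
    ((Polynomial.C : ℍ[ℝ] →+* ℍ[ℝ][X]).comp (Quaternion.ofComplex : ℂ →+* ℍ[ℝ]))
    (powersHom ℍ[ℝ][X] (Polynomial.C j * Polynomial.X))
    (by
      intro a n
      rw [powersHom_apply, (Polynomial.commute_X _).symm.mul_pow, ← Polynomial.C_pow]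
      simp only [RingHom.comp_apply, RingHom.coe_coe, Quaternion.coe_ofComplex, conjAction_smul]
      rw [← mul_assoc, ← Polynomial.C_mul, ← j_pow_mul_coe, mul_assoc,
        Polynomial.X_pow_mul, ← mul_assoc, Polynomial.C_mul])

theorem phiPoly_monomial (n : ℕ) (a : ℂ) :
    phiPoly (SkewPolynomial.monomial n a) = Polynomial.monomial n ((a : ℍ[ℝ]) * j ^ n) := by
  have h : phiPoly (SkewPolynomial.monomial n a) =
      Polynomial.C (a : ℍ[ℝ]) * (Polynomial.C j * Polynomial.X) ^ n :=
    SkewMonoidAlgebra.liftNC_single _ _ _ _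
  rw [h, (Polynomial.commute_X _).symm.mul_pow, ← Polynomial.C_pow, ← mul_assoc,
    ← Polynomial.C_mul, Polynomial.C_mul_X_pow_eq_monomial]

theorem coeff_phiPoly (p : SkewPoly) (n : ℕ) :
    (phiPoly p).coeff n = (p.coeff n : ℍ[ℝ]) * j ^ n := by
  induction p using SkewPolynomial.induction with
  | h0 => simp
  | ha m r q _ _ ih =>
    rw [map_add, Polynomial.coeff_add, ih, phiPoly_monomial, Polynomial.coeff_monomial,
      SkewPolynomial.coeff_add, SkewPolynomial.coeff_monomial, Quaternion.coeComplex_add, add_mul]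
    split_ifs with h
    · rw [h]
    · simp

theorem phiPoly_injective : Function.Injective phiPoly := by
  rw [injective_iff_map_eq_zero]
  intro p hp
  refine SkewPolynomial.ext fun n => ?_
  have h := coeff_phiPoly p n
  rw [hp, Polynomial.coeff_zero, eq_comm, mul_eq_zero] at h
  have h' := h.resolve_right (pow_ne_zero n j_ne_zero)
  rw [SkewPolynomial.coeff_zero]
  apply Complex.ext
  · simpa using congrArg QuaternionAlgebra.re h'
  · simpa using congrArg QuaternionAlgebra.imI h'

instance skewPolyNoZeroDivisors : NoZeroDivisors SkewPoly :=
  phiPoly_injective.noZeroDivisors phiPoly (map_zero phiPoly) (map_mul phiPoly)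

theorem skewPoly_cancel {a t : SkewPoly} (ha : a ≠ 0)
    (ht : (phiPoly t).natDegree = (phiPoly a).natDegree)
    (hc : (phiPoly t).leadingCoeff = (phiPoly a).leadingCoeff) :
    a = t ∨ (phiPoly (a - t)).natDegree < (phiPoly a).natDegree := by
  rw [map_sub]
  exact (quatPoly_cancel ((map_ne_zero_iff _ phiPoly_injective).mpr ha) ht hc).imp_left
    fun h => phiPoly_injective h

theorem coeff_natDegree_ne_zero {a : SkewPoly} (ha : a ≠ 0) :
    a.coeff (phiPoly a).natDegree ≠ 0 := by
  intro h
  have h' := coeff_phiPoly a (phiPoly a).natDegree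
  rw [h, Quaternion.coeComplex_zero, zero_mul] at h'
  exact ha ((map_eq_zero_iff _ phiPoly_injective).mp (Polynomial.leadingCoeff_eq_zero.mp h'))

theorem coe_mul_j_pow_ne_zero {c : ℂ} (hc : c ≠ 0) (k : ℕ) : (c : ℍ[ℝ]) * j ^ k ≠ 0 :=
  mul_ne_zero ((map_ne_zero_iff (Quaternion.ofComplex : ℂ →+* ℍ[ℝ])
    (RingHom.injective _)).mpr hc) (pow_ne_zero k j_ne_zero)

theorem skewPoly_step_left (a b : SkewPoly) (ha : a ≠ 0) (hb : b ≠ 0)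
    (h : (phiPoly b).natDegree ≤ (phiPoly a).natDegree) :
    ∃ q, a = q * b ∨ (phiPoly (a - q * b)).natDegree < (phiPoly a).natDegree := by
  obtain ⟨k, hk⟩ := Nat.exists_eq_add_of_le' h
  set m := (phiPoly b).natDegree with hm
  have hb0 := coeff_natDegree_ne_zero hb
  have ha0 := coeff_natDegree_ne_zero ha
  rw [← hm] at hb0
  have hs : (starRingEnd ℂ)^[k] (b.coeff m) ≠ 0 := by
    intro h0
    rw [← iterate_map_zero (starRingEnd ℂ) k] at h0
    exact hb0 ((RingHom.injective (starRingEnd ℂ)).iterate k h0)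
  have hc := coe_mul_j_pow_ne_zero (mul_ne_zero ha0 (inv_ne_zero hs)) k
  have hq : Polynomial.monomial k ((a.coeff (phiPoly a).natDegree *
      ((starRingEnd ℂ)^[k] (b.coeff m))⁻¹ : ℂ) * j ^ k : ℍ[ℝ]) ≠ 0 := by
    simpa only [ne_eq, Polynomial.monomial_eq_zero_iff] using hc
  have hb' : phiPoly b ≠ 0 := (map_ne_zero_iff _ phiPoly_injective).mpr hb
  refine ⟨SkewPolynomial.monomial k (a.coeff (phiPoly a).natDegree *
      ((starRingEnd ℂ)^[k] (b.coeff m))⁻¹), skewPoly_cancel ha ?_ ?_⟩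
  · rw [map_mul, phiPoly_monomial, Polynomial.natDegree_mul hq hb',
      Polynomial.natDegree_monomial_eq _ hc, ← hm, hk]
  · rw [map_mul, phiPoly_monomial, Polynomial.leadingCoeff_mul, Polynomial.leadingCoeff_monomial,
      Polynomial.leadingCoeff, Polynomial.leadingCoeff, coeff_phiPoly, coeff_phiPoly, ← hm,
      ← mul_assoc, mul_assoc _ (j ^ k), j_pow_mul_coe, ← mul_assoc, ← Quaternion.coeComplex_mul,
      inv_mul_cancel_right₀ hs, mul_assoc, ← pow_add, hk]

theorem skewPoly_step_right (a b : SkewPoly) (ha : a ≠ 0) (hb : b ≠ 0)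
    (h : (phiPoly b).natDegree ≤ (phiPoly a).natDegree) :
    ∃ q, a = b * q ∨ (phiPoly (a - b * q)).natDegree < (phiPoly a).natDegree := by
  obtain ⟨k, hk⟩ := Nat.exists_eq_add_of_le h
  set m := (phiPoly b).natDegree with hm
  have hb0 := coeff_natDegree_ne_zero hb
  have ha0 := coeff_natDegree_ne_zero ha
  rw [← hm] at hb0
  obtain ⟨c, hcm⟩ : ∃ c, (starRingEnd ℂ)^[m] c =
      (b.coeff m)⁻¹ * a.coeff (phiPoly a).natDegree :=
    (Function.Involutive.surjective Complex.conj_conj).iterate m _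
  have hc0 : c ≠ 0 := by
    rintro rfl
    rw [iterate_map_zero] at hcm
    exact mul_ne_zero (inv_ne_zero hb0) ha0 hcm.symm
  have hc := coe_mul_j_pow_ne_zero hc0 k
  have hq : Polynomial.monomial k ((c : ℍ[ℝ]) * j ^ k) ≠ 0 := by
    simpa only [ne_eq, Polynomial.monomial_eq_zero_iff] using hc
  have hb' : phiPoly b ≠ 0 := (map_ne_zero_iff _ phiPoly_injective).mpr hb
  refine ⟨SkewPolynomial.monomial k c, skewPoly_cancel ha ?_ ?_⟩
  · rw [map_mul, phiPoly_monomial, Polynomial.natDegree_mul hb' hq,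
      Polynomial.natDegree_monomial_eq _ hc, ← hm, hk]
  · rw [map_mul, phiPoly_monomial, Polynomial.leadingCoeff_mul, Polynomial.leadingCoeff_monomial,
      Polynomial.leadingCoeff, Polynomial.leadingCoeff, coeff_phiPoly, coeff_phiPoly, ← hm,
      ← mul_assoc, mul_assoc _ (j ^ m), j_pow_mul_coe, ← mul_assoc, ← Quaternion.coeComplex_mul,
      hcm, mul_inv_cancel_left₀ hb0, mul_assoc, ← pow_add, hk]

instance skewPolyOreSet : OreLocalization.OreSet SkewPoly⁰ :=
  oreSet (left_ore_of_step (fun p => (phiPoly p).natDegree) skewPoly_step_left)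

/-- The division ring `ℂ(T, σ)`, with `σ` the complex conjugation. -/
abbrev SkewFrac : Type := Frac SkewPoly

theorem SkewFrac.exists_eq_mul_inv (x : SkewFrac) :
    ∃ P Q : SkewPoly, Q ≠ 0 ∧ x = toFrac _ P * (toFrac _ Q)⁻¹ :=
  ConjSkew.exists_eq_mul_inv
    (right_ore_of_step (fun p => (phiPoly p).natDegree) skewPoly_step_right) x

/-- The inclusion of `ℂ` in `ℂ(T, σ)`, as the constant polynomials. -/
def ofComplex : ℂ →+* SkewFrac := (toFrac SkewPoly).comp SkewPolynomial.CRingHom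

/-- The embedding `φ` of `ℂ(T, σ)` in `ℍ(X)`, which maps `T` to `j X` and is the identity
on `ℂ`. -/
def phi : SkewFrac →+* QuatFrac :=
  fracLift ((toFrac ℍ[ℝ][X]).comp phiPoly) (toFrac_injective.comp phiPoly_injective)

theorem phi_mul_inv (P Q : SkewPoly) :
    phi (toFrac _ P * (toFrac _ Q)⁻¹) = toFrac _ (phiPoly P) * (toFrac _ (phiPoly Q))⁻¹ :=
  fracLift_mul_inv _ _ P Q

theorem phi_ofComplex (z : ℂ) : phi (ofComplex z) = toFrac _ (Polynomial.C (z : ℍ[ℝ])) := by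
  refine (fracLift_toFrac _ _ _).trans (congrArg (toFrac ℍ[ℝ][X]) ?_)
  refine (phiPoly_monomial 0 z).trans ?_
  rw [pow_zero, mul_one, Polynomial.monomial_zero_left]

theorem phi_T : phi (toFrac _ SkewPolynomial.X) =
    toFrac _ (Polynomial.C j * Polynomial.X) := by
  refine (fracLift_toFrac _ _ _).trans (congrArg (toFrac ℍ[ℝ][X]) ?_)
  refine (phiPoly_monomial 1 1).trans ?_
  rw [pow_one, Quaternion.coeComplex_one, one_mul, Polynomial.C_mul_X_eq_monomial]

/-- For a subset `S` of `ℂ(T, σ)`, the division ring `ℂ(S)`: the intersection of all division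
rings contained in `ℂ(T, σ)` which contain both `ℂ` and `S`. (Mathlib's `Subfield`, over a
division ring, means a sub-division-ring, not necessarily commutative.) -/
def adjoin (S : Set SkewFrac) : Subfield SkewFrac :=
  sInf {M : Subfield SkewFrac | Set.range ofComplex ⊆ M ∧ S ⊆ M}

end ConjSkew

end

/-! Let `T` be the variable of `ℂ(T, σ)`. As `T` commutes with `T²` and `T z = σ(z) T`, the
subfield `ℂ(T²)` is a rational function field over `ℂ`, it is stable under conjugation by `T`,
and `ℂ(T, σ) = ℂ(T²) ⊕ ℂ(T²) T` (`exists_eq_evenFrac_add`). The complex number `i` commutes with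
the first summand and anticommutes with the second; in particular, the centralizer of `i` is
`ℂ(T²)` (`exists_evenFrac_eq_of_commute`).

A division ring `L` that contains `ℂ` inherits this grading, `L = L₀ ⊕ L₁`, because the components
of `x` are `(x ∓ i x i) / 2` (`exists_eq_add_of_mem`). The field `L₀` lies between `ℂ` and `ℂ(T²)`,
so `L₀ = ℂ(w)` by Lüroth's theorem (`exists_generator_of_commute`). If `L₁` contains some `u ≠ 0`,
then `L₁ = L₀ u`, since a product of two elements that anticommute with `i` commutes with `i`;
otherwise put `u = 0`. Then `v = w + u` generates `L`: the division ring `ℂ(v)` is graded too, so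
it contains the components `w` and `u` of `v`, and hence `L₀` and `L₁`. -/

namespace ConjSkew

noncomputable section

/-! ### The subfield `ℂ(T²)` of `ℂ(T, σ)` -/

/-- The ring homomorphism `ℂ[X] → ℂ[T, σ]` that is the identity on `ℂ` and maps `X` to `T²`. -/
def evenPoly : ℂ[X] →+* SkewPoly :=
  Polynomial.eval₂RingHom' SkewPolynomial.CRingHom (SkewPolynomial.monomial 2 1) fun a => by
    change (SkewPolynomial.monomial 0 a : SkewPoly) * _ = _ * SkewPolynomial.monomial 0 a
    rw [monomial_mul_monomial, monomial_mul_monomial]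
    simp

theorem evenPoly_monomial (n : ℕ) (a : ℂ) :
    evenPoly (Polynomial.monomial n a) = SkewPolynomial.monomial (2 * n) a := by
  have hpow : (SkewPolynomial.monomial 2 1 : SkewPoly) ^ n =
      SkewPolynomial.monomial (2 * n) 1 := by
    induction n with
    | zero => rfl
    | succ n ih =>
      rw [pow_succ, ih, monomial_mul_monomial, iterate_map_one, mul_one, mul_add_one]
  refine (Polynomial.eval₂_monomial _ _).trans ?_
  rw [hpow]
  change (SkewPolynomial.monomial 0 a : SkewPoly) * _ = _
  simp

theorem coeff_evenPoly (p : ℂ[X]) (n : ℕ) : (evenPoly p).coeff (2 * n) = p.coeff n := by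
  induction p using Polynomial.induction_on' with
  | add p q hp hq => rw [map_add, SkewPolynomial.coeff_add, hp, hq, Polynomial.coeff_add]
  | monomial m a =>
    rw [evenPoly_monomial, SkewPolynomial.coeff_monomial, Polynomial.coeff_monomial]
    simp

theorem evenPoly_injective : Function.Injective evenPoly := fun p q h =>
  Polynomial.ext fun n => by rw [← coeff_evenPoly, h, coeff_evenPoly]

theorem X_mul_evenPoly (p : ℂ[X]) :
    SkewPolynomial.X * evenPoly p =
      evenPoly (p.map (starRingEnd ℂ)) * (SkewPolynomial.X : SkewPoly) := by
  induction p using Polynomial.induction_on' with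
  | add p q hp hq => rw [map_add, mul_add, hp, hq, Polynomial.map_add, map_add, add_mul]
  | monomial m a =>
    rw [Polynomial.map_monomial, evenPoly_monomial, evenPoly_monomial]
    change (SkewPolynomial.monomial 1 1 : SkewPoly) * _ = _ * SkewPolynomial.monomial 1 1
    rw [monomial_mul_monomial, monomial_mul_monomial, iterate_map_one, mul_one, one_mul, add_comm]
    rfl

theorem exists_evenPoly_add_mul_X (P : SkewPoly) :
    ∃ p q : ℂ[X], P = evenPoly p + evenPoly q * SkewPolynomial.X := by
  induction P using SkewPolynomial.induction with
  | h0 => exact ⟨0, 0, by simp⟩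
  | ha n a P _ _ ih =>
    obtain ⟨p, q, rfl⟩ := ih
    rcases Nat.even_or_odd' n with ⟨k, rfl | rfl⟩
    · refine ⟨Polynomial.monomial k a + p, q, ?_⟩
      rw [map_add, evenPoly_monomial, add_assoc]
    · refine ⟨p, Polynomial.monomial k a + q, ?_⟩
      have h : (SkewPolynomial.monomial (2 * k) a : SkewPoly) * SkewPolynomial.X =
          SkewPolynomial.monomial (2 * k + 1) a := by
        refine (monomial_mul_monomial _ _ _ _).trans ?_
        rw [iterate_map_one, mul_one]
      rw [map_add, evenPoly_monomial, add_mul, h]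
      abel

/-- The embedding `ℂ(X) → ℂ(T, σ)` that is the identity on `ℂ` and maps `X` to `T²`. Mathlib's
lifts from `RatFunc` need a commutative target, hence the passage through the Ore localization. -/
def evenFrac : RatFunc ℂ →+* SkewFrac :=
  (fracLift ((toFrac SkewPoly).comp evenPoly)
    (toFrac_injective.comp evenPoly_injective)).comp
      (RatFunc.toFractionRingRingEquiv ℂ : RatFunc ℂ →+* FractionRing ℂ[X])

theorem evenFrac_algebraMap (p : ℂ[X]) :
    evenFrac (algebraMap ℂ[X] (RatFunc ℂ) p) = toFrac SkewPoly (evenPoly p) := by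
  rw [← RatFunc.ofFractionRing_algebraMap]
  exact fracLift_toFrac ((toFrac SkewPoly).comp evenPoly)
    (toFrac_injective.comp evenPoly_injective) p

theorem evenFrac_C (z : ℂ) : evenFrac (RatFunc.C z) = ofComplex z := by
  rw [← RatFunc.algebraMap_C, evenFrac_algebraMap, ← Polynomial.monomial_zero_left,
    evenPoly_monomial]
  rfl

/-- The variable `T` of `ℂ(T, σ)`. -/
def varT : SkewFrac := toFrac SkewPoly SkewPolynomial.X

theorem varT_mul_ofComplex (z : ℂ) :
    varT * ofComplex z = ofComplex (starRingEnd ℂ z) * varT := by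
  have h := congrArg (toFrac SkewPoly) (X_mul_evenPoly (Polynomial.C z))
  rw [map_mul, map_mul, ← evenFrac_algebraMap, ← evenFrac_algebraMap, Polynomial.map_C,
    RatFunc.algebraMap_C, RatFunc.algebraMap_C, evenFrac_C, evenFrac_C] at h
  exact h

/-- Conjugation by `T` maps `ℂ(T²)` to itself. -/
theorem exists_varT_mul_evenFrac (x : RatFunc ℂ) :
    ∃ y, varT * evenFrac x = evenFrac y * varT := by
  have hT (p : ℂ[X]) : varT * toFrac SkewPoly (evenPoly p) =
      toFrac SkewPoly (evenPoly (p.map (starRingEnd ℂ))) * varT := by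
    rw [varT, ← map_mul, ← map_mul, X_mul_evenPoly]
  refine ⟨algebraMap ℂ[X] _ (x.num.map (starRingEnd ℂ)) /
    algebraMap ℂ[X] _ (x.denom.map (starRingEnd ℂ)), ?_⟩
  have h1 : toFrac SkewPoly (evenPoly x.denom) ≠ 0 :=
    toFrac_ne_zero ((map_ne_zero_iff _ evenPoly_injective).mpr x.denom_ne_zero)
  have h2 : toFrac SkewPoly (evenPoly (x.denom.map (starRingEnd ℂ))) ≠ 0 :=
    toFrac_ne_zero ((map_ne_zero_iff _ evenPoly_injective).mpr
      (Polynomial.map_ne_zero x.denom_ne_zero))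
  conv_lhs => rw [← RatFunc.num_div_denom x]
  rw [map_div₀, map_div₀, evenFrac_algebraMap, evenFrac_algebraMap, evenFrac_algebraMap,
    evenFrac_algebraMap, div_eq_mul_inv, div_eq_mul_inv, ← mul_assoc, hT, mul_assoc, mul_assoc]
  congr 1
  rw [mul_inv_eq_iff_eq_mul₀ h1, mul_assoc, hT, inv_mul_cancel_left₀ h2]

theorem varT_mul_varT : varT * varT = evenFrac RatFunc.X := by
  rw [← RatFunc.algebraMap_X, evenFrac_algebraMap, ← Polynomial.monomial_one_one_eq_X,
    evenPoly_monomial, varT, ← map_mul]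
  congr 1
  refine (monomial_mul_monomial _ _ _ _).trans ?_
  simp

/-- The imaginary unit as an element of `ℂ(T, σ)`. -/
def imagUnit : SkewFrac := ofComplex Complex.I

theorem imagUnit_mul_imagUnit : imagUnit * imagUnit = -1 := by
  rw [imagUnit, ← map_mul, Complex.I_mul_I, map_neg, map_one]

theorem imagUnit_ne_zero : imagUnit ≠ 0 :=
  (map_ne_zero _).mpr Complex.I_ne_zero

theorem skewFrac_two_ne_zero : (2 : SkewFrac) ≠ 0 := by
  rw [← map_ofNat ofComplex 2]
  exact (map_ne_zero _).mpr two_ne_zero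

theorem varT_mul_imagUnit : varT * imagUnit = -(imagUnit * varT) := by
  rw [imagUnit, varT_mul_ofComplex, Complex.conj_I, map_neg, neg_mul]

theorem imagUnit_commute_evenFrac (x : RatFunc ℂ) : Commute imagUnit (evenFrac x) := by
  rw [imagUnit, ← evenFrac_C]
  exact (Commute.all _ _).map evenFrac

theorem evenFrac_mul_varT_mul_imagUnit (x : RatFunc ℂ) :
    evenFrac x * varT * imagUnit = -(imagUnit * (evenFrac x * varT)) := by
  rw [mul_assoc, varT_mul_imagUnit, mul_neg, ← mul_assoc, ← mul_assoc,
    (imagUnit_commute_evenFrac x).eq]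

theorem varT_ne_zero : varT ≠ 0 := by
  intro h
  have h2 := varT_mul_varT
  rw [h, zero_mul, eq_comm, map_eq_zero] at h2
  exact RatFunc.X_ne_zero h2

/-- An element that commutes and anticommutes with `i` vanishes. -/
theorem eq_zero_of_imagUnit {x : SkewFrac} (h : Commute imagUnit x)
    (h' : x * imagUnit = -(imagUnit * x)) : x = 0 := by
  have h2 : 2 * (imagUnit * x) = 0 := by
    rw [two_mul]
    nth_rw 1 [h.eq, h', neg_add_cancel]
  exact (mul_eq_zero.mp ((mul_eq_zero.mp h2).resolve_left skewFrac_two_ne_zero)).resolve_left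
    imagUnit_ne_zero

/-- The inverse of `a + b T` is `(σ(a) - b T) (a σ(a) - b σ(b) T²)⁻¹`. -/
theorem exists_inv_eq_evenFrac_add (a b : RatFunc ℂ) :
    ∃ c d, (evenFrac a + evenFrac b * varT)⁻¹ = evenFrac c + evenFrac d * varT := by
  obtain ⟨a', ha⟩ := exists_varT_mul_evenFrac a
  obtain ⟨b', hb⟩ := exists_varT_mul_evenFrac b
  obtain ⟨b', hb⟩ := exists_varT_mul_evenFrac b
  have ha' : varT * evenFrac a' = evenFrac a * varT := by
    refine mul_right_cancel₀ varT_ne_zero ?_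
    rw [mul_assoc, ← ha, ← mul_assoc, varT_mul_varT, mul_assoc, varT_mul_varT, ← map_mul,
      ← map_mul, mul_comm]
  set N := a * a' - b * b' * RatFunc.X with hN
  have key : (evenFrac a + evenFrac b * varT) * (evenFrac a' - evenFrac b * varT) =
      evenFrac N := by
    have h1 : evenFrac b * varT * evenFrac a' = evenFrac a * (evenFrac b * varT) := by
      rw [mul_assoc, ha', ← mul_assoc, ← mul_assoc, ← map_mul, ← map_mul, mul_comm]
    have h2 : evenFrac b * varT * (evenFrac b * varT) = evenFrac (b * b' * RatFunc.X) := by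
      rw [mul_assoc, ← mul_assoc varT, hb, mul_assoc (evenFrac b'), varT_mul_varT, ← mul_assoc,
        map_mul, map_mul]
    rw [add_mul, mul_sub, mul_sub, h1, h2, hN, map_sub, map_mul evenFrac a]
    abel
  by_cases hx : evenFrac a + evenFrac b * varT = 0
  · exact ⟨0, 0, by simp [hx]⟩
  have hN0 : N ≠ 0 := by
    intro h0
    rw [h0, map_zero, mul_eq_zero, sub_eq_zero] at key
    have h1 := key.resolve_left hx
    have h2 : evenFrac a' = 0 := eq_zero_of_imagUnit (imagUnit_commute_evenFrac a') (by
      rw [h1, evenFrac_mul_varT_mul_imagUnit])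
    rw [h2, mul_zero] at ha'
    rw [← h1, h2, add_zero] at hx
    exact hx ((mul_eq_zero.mp ha'.symm).resolve_right varT_ne_zero)
  obtain ⟨m, hm⟩ := exists_varT_mul_evenFrac N⁻¹
  refine ⟨a' * N⁻¹, -(b * m), inv_eq_of_mul_eq_one_right ?_⟩
  have h1 : evenFrac (a' * N⁻¹) + evenFrac (-(b * m)) * varT =
      (evenFrac a' - evenFrac b * varT) * evenFrac N⁻¹ := by
    rw [sub_mul, mul_assoc _ varT, hm, map_mul, map_neg, map_mul]
    noncomm_ring
  rw [h1, ← mul_assoc, key, ← map_mul, mul_inv_cancel₀ hN0, map_one]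

/-- `ℂ(T, σ) = ℂ(T²) + ℂ(T²) T`: the right-hand side is closed under products and inverses,
and contains all skew polynomials. -/
theorem exists_eq_evenFrac_add (x : SkewFrac) :
    ∃ a b, x = evenFrac a + evenFrac b * varT := by
  have hpoly (P : SkewPoly) : ∃ a b, toFrac SkewPoly P = evenFrac a + evenFrac b * varT := by
    obtain ⟨p, q, rfl⟩ := exists_evenPoly_add_mul_X P
    refine ⟨algebraMap _ _ p, algebraMap _ _ q, ?_⟩
    rw [evenFrac_algebraMap, evenFrac_algebraMap, map_add, map_mul, varT]
  obtain ⟨P, Q, -, rfl⟩ := SkewFrac.exists_eq_mul_inv x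
  obtain ⟨a, b, hP⟩ := hpoly P
  obtain ⟨a₁, b₁, hQ⟩ := hpoly Q
  obtain ⟨c, d, hQ'⟩ := exists_inv_eq_evenFrac_add a₁ b₁
  obtain ⟨c', hc⟩ := exists_varT_mul_evenFrac c
  obtain ⟨d', hd⟩ := exists_varT_mul_evenFrac d
  refine ⟨a * c + b * d' * RatFunc.X, a * d + b * c', ?_⟩
  have h1 : evenFrac b * varT * evenFrac c = evenFrac (b * c') * varT := by
    rw [mul_assoc, hc, ← mul_assoc, map_mul]
  have h2 : evenFrac b * varT * (evenFrac d * varT) = evenFrac (b * d' * RatFunc.X) := by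
    rw [mul_assoc, ← mul_assoc varT, hd, mul_assoc (evenFrac d'), varT_mul_varT, ← mul_assoc,
      map_mul, map_mul]
  rw [hP, hQ, hQ', add_mul, mul_add, mul_add, h1, h2, ← mul_assoc, map_add, map_add,
    map_mul evenFrac a, map_mul evenFrac a, add_mul]
  abel

/-- The centralizer of `i` is `ℂ(T²)`. -/
theorem exists_evenFrac_eq_of_commute {x : SkewFrac} (h : Commute imagUnit x) :
    ∃ a, evenFrac a = x := by
  obtain ⟨a, b, rfl⟩ := exists_eq_evenFrac_add x
  have h0 : evenFrac b * varT = 0 := by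
    refine eq_zero_of_imagUnit ?_ (evenFrac_mul_varT_mul_imagUnit b)
    simpa using h.sub_right (imagUnit_commute_evenFrac a)
  exact ⟨a, by rw [h0, add_zero]⟩

/-! ### Division rings between `ℂ` and `ℂ(T, σ)` -/

theorem ofComplex_mem_adjoin (S : Set SkewFrac) (z : ℂ) : ofComplex z ∈ adjoin S :=
  Subfield.mem_sInf.mpr fun _ hM => hM.1 ⟨z, rfl⟩

theorem subset_adjoin (S : Set SkewFrac) : S ⊆ adjoin S := fun _ hx =>
  Subfield.mem_sInf.mpr fun _ hM => hM.2 hx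

theorem adjoin_le {S : Set SkewFrac} {M : Subfield SkewFrac} (hC : ∀ z, ofComplex z ∈ M)
    (hS : S ⊆ M) : adjoin S ≤ M :=
  sInf_le ⟨Set.range_subset_iff.mpr hC, hS⟩

/-- Lüroth's theorem for the part of `L` that commutes with `i`. -/
theorem exists_generator_of_commute (L : Subfield SkewFrac) (hL : ∀ z, ofComplex z ∈ L) :
    ∃ w ∈ L, Commute imagUnit w ∧
      ∀ M : Subfield SkewFrac, (∀ z, ofComplex z ∈ M) → w ∈ M →
        ∀ x ∈ L, Commute imagUnit x → x ∈ M := by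
  -- A subfield of `ℂ(T, σ)` containing `ℂ`, pulled back to `ℂ(X)`.
  let pull (M : Subfield SkewFrac) (hM : ∀ z, ofComplex z ∈ M) :
      IntermediateField ℂ (RatFunc ℂ) :=
    { M.comap evenFrac with
      algebraMap_mem' := fun z => by
        change evenFrac (RatFunc.C z) ∈ M
        rw [evenFrac_C]
        exact hM z }
  let E := pull L hL
  refine ⟨evenFrac (RatFunc.Luroth.generator E), RatFunc.Luroth.generator_mem (E := E),
    imagUnit_commute_evenFrac _, fun M hM hw x hx hxi => ?_⟩
  obtain ⟨a, rfl⟩ := exists_evenFrac_eq_of_commute hxi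
  have hE : E ≤ pull M hM := by
    rw [RatFunc.Luroth.eq_adjoin_generator (E := E), IntermediateField.adjoin_simple_le_iff]
    exact hw
  exact hE hx

/-- Every element of `L` is the sum of one that commutes and one that anticommutes with `i`. -/
theorem exists_eq_add_of_mem {L : Subfield SkewFrac} (hi : imagUnit ∈ L) {x : SkewFrac}
    (hx : x ∈ L) : ∃ y ∈ L, ∃ z ∈ L, Commute imagUnit y ∧ z * imagUnit = -(imagUnit * z) ∧
      x = y + z := by
  have h2 : (2 : SkewFrac)⁻¹ ∈ L := L.inv_mem (ofNat_mem L 2)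
  have hc (t : SkewFrac) : t * 2⁻¹ = 2⁻¹ * t :=
    ((Nat.cast_commute 2 t).inv_left₀.eq).symm
  have hI (t : SkewFrac) : imagUnit * (imagUnit * t) = -t := by
    rw [← mul_assoc, imagUnit_mul_imagUnit, neg_one_mul]
  have hI' (t : SkewFrac) : t * imagUnit * imagUnit = -t := by
    rw [mul_assoc, imagUnit_mul_imagUnit, mul_neg_one]
  -- The components are `(x ∓ i x i) / 2`, as `i⁻¹ = -i`.
  refine ⟨2⁻¹ * (x - imagUnit * x * imagUnit),
    L.mul_mem h2 (L.sub_mem hx (L.mul_mem (L.mul_mem hi hx) hi)),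
    2⁻¹ * (x + imagUnit * x * imagUnit),
    L.mul_mem h2 (L.add_mem hx (L.mul_mem (L.mul_mem hi hx) hi)), ?_, ?_, ?_⟩
  · refine Commute.mul_right (hc _) ?_
    rw [commute_iff_eq, mul_sub, sub_mul, hI', mul_assoc imagUnit x, hI]
    abel
  · have h : (x + imagUnit * x * imagUnit) * imagUnit =
        -(imagUnit * (x + imagUnit * x * imagUnit)) := by
      rw [mul_add, add_mul, hI', mul_assoc imagUnit x, hI]
      abel
    rw [mul_assoc, h, mul_neg, ← mul_assoc, ← mul_assoc, hc]
  · rw [← mul_add, sub_add_add_cancel, ← two_mul, inv_mul_cancel_left₀ skewFrac_two_ne_zero]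

end

end ConjSkew

theorem theorem4p3 (L : Subfield ConjSkew.SkewFrac)
    (hL : Set.range ConjSkew.ofComplex ⊆ (L : Set ConjSkew.SkewFrac))
    (hinv : ConjSkew.IsSigmaInvariant (ConjSkew.phi '' (L : Set ConjSkew.SkewFrac))) :
    ∃ v : ConjSkew.SkewFrac, L = ConjSkew.adjoin {v} := by
  open ConjSkew in
  have hC (z : ℂ) : ofComplex z ∈ L := hL ⟨z, rfl⟩
  have hi : imagUnit ∈ L := hC _
  obtain ⟨w, hwL, hwi, hw⟩ := exists_generator_of_commute L hC
  -- `u` spans the anticommuting part over the commuting part; `u = 0` if the former vanishes.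
  obtain ⟨u, huL, hui, hu⟩ : ∃ u ∈ L, u * imagUnit = -(imagUnit * u) ∧
      (u = 0 → ∀ z ∈ L, z * imagUnit = -(imagUnit * z) → z = 0) := by
    by_cases h : ∃ u ∈ L, u * imagUnit = -(imagUnit * u) ∧ u ≠ 0
    · obtain ⟨u, huL, hui, hu0⟩ := h
      exact ⟨u, huL, hui, fun h0 => absurd h0 hu0⟩
    · push Not at h
      exact ⟨0, L.zero_mem, by simp, fun _ => h⟩
  refine ⟨w + u, le_antisymm (fun x hx => ?_)
    (adjoin_le hC (Set.singleton_subset_iff.mpr (L.add_mem hwL huL)))⟩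
  set M := adjoin {w + u}
  have hMC (z : ℂ) : ofComplex z ∈ M := ofComplex_mem_adjoin _ z
  have hMi : imagUnit ∈ M := hMC _
  have hv : w + u ∈ M := subset_adjoin _ rfl
  obtain ⟨w', hw'M, u', hu'M, hw'i, hu'i, hwu⟩ := exists_eq_add_of_mem hMi hv
  -- Components are unique, so `w` and `u` are the components of `w + u`, which lie in `M`.
  have hww : w - w' = u' - u := by
    rw [sub_eq_sub_iff_add_eq_add, hwu, add_comm]
  have h0 : w - w' = 0 := eq_zero_of_imagUnit (hwi.sub_right hw'i) (by
    rw [hww, sub_mul, mul_sub, hui, hu'i]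
    abel)
  have hwM : w ∈ M := by rwa [sub_eq_zero.mp h0]
  have huM : u ∈ M := by
    rw [h0, eq_comm, sub_eq_zero] at hww
    rwa [← hww]
  obtain ⟨y, hyL, z, hzL, hyi, hzi, rfl⟩ := exists_eq_add_of_mem hi hx
  refine M.add_mem (hw M hMC hwM y hyL hyi) ?_
  by_cases hu0 : u = 0
  · rw [hu hu0 z hzL hzi]
    exact M.zero_mem
  · have huI : SemiconjBy u⁻¹ (-imagUnit) imagUnit :=
      SemiconjBy.inv_symm_left₀ (show u * imagUnit = -imagUnit * u by rw [hui, neg_mul])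
    have hzu : Commute imagUnit (z * u⁻¹) := by
      rw [commute_iff_eq, ← mul_assoc, mul_assoc z, ← neg_neg imagUnit, mul_neg u⁻¹, huI.eq,
        mul_neg, ← mul_assoc, hzi, neg_neg, neg_mul, neg_neg]
    rw [← inv_mul_cancel_right₀ hu0 z]
    exact M.mul_mem (hw M hMC hwM _ (L.mul_mem hzL (L.inv_mem huL)) hzu) huM
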